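/- Let $\Gamma$ be a finite compact metric graph (loops and parallel edges allowed) with edges $e$ of lengths $\ell_e>0$, carrying the operator $-\frac{d^2}{dx^2}$ with standard (Neumann) vertex conditions: functions are continuous at the vertices, and at every vertex the sum of the outward normal derivatives vanishes. For $k\in\mathbb C\setminus\{0\}$ let $\mu_\Gamma(k)$ be the dimension of the space of functions on $\Gamma$ that satisfy $-f''=k^2f$ on every edge and the vertex conditions. A *secular function* of $\Gamma$ is an entire function $\Sigma$ whose order of vanishing at every $k\in\mathbb C\setminus\{0\}$ is $\mu_\Gamma(k)$. The *secular determinant* of $\Gamma$ is $\Sigma^{\Gamma}_{\det}(k)=\det(I-S_vS_e(k))$, with matrices indexed by the directed edges: $S_e(k)$ is diagonal with entry $e^{ik\ell_e}$ at both directions of $e$; and $(S_v)_{b',b}$ is $0$ unless $b'$ starts at the vertex $v$ where $b$ ends, in which case it is $\frac2{d_v}-1$ if $b'$ is the reversal of $b$ and $\frac2{d_v}$ otherwise, where $d_v$ is the number of edge ends at $v$. Let $\Gamma\sqcup\Gamma$ be the graph obtained from two copies of $\Gamma$ by identifying the two copies of every vertex, so that each edge $e$ is replaced by two parallel edges of length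 $\ell_e$, which form a loop of length $2\ell_e$ (if $e$ is itself a loop of $\Gamma$, the two copies of $e$ are counted together as one loop of length $2\ell_e$). Suppose that these loops consist of $n_i$ loops of length $L_i$, $i=1,\dots,m$. Then: 1. If $\Sigma^\Gamma$ is a secular function of $\Gamma$, then $$\Sigma^{\Gamma\sqcup\Gamma}(k)=\Sigma^\Gamma(k)\prod_{i=1}^m\left(e^{ikL_i}-1\right)^{n_i}$$ is a secular function of $\Gamma\sqcup\Gamma$. 2. The secular determinants satisfy the same identity up to a constant sign: for all $k\in\mathbb C$, $$\Sigma^{\Gamma\sqcup\Gamma}_{\det}(k)=(-1)^{n}\,\Sigma^\Gamma_{\det}(k)\prod_{i=1}^m\left(e^{ikL_i}-1\right)^{n_i},$$ where $n=n_1+\dots+n_m$ is the number of edges of $\Gamma$. 3. For every $k\in\mathbb C\setminus\{0\}$, $\mu_{\Gamma\sqcup\Gamma}(k)=\mu_\Gamma(k)+\sum_{i:\,e^{ikL_i}=1}n_i$. -/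

import Mathlib

open Finset

/-- A finite metric graph on vertices `V` and edges `E`; loops and parallel edges are allowed.
The edge `e` is identified with the interval `[0, length e]`, the endpoint `0` being attached to the
vertex `src e` and the endpoint `length e` to the vertex `tgt e`. -/
structure MetricGraph (V E : Type*) where
  src : E → V
  tgt : E → V
  length : E → ℝ
  length_pos : ∀ e, 0 < length e

namespace MetricGraph

section Spectral

variable {V E : Type*} [Fintype E] [DecidableEq V]

/-- `f` together with its edgewise derivative `f'` solves `-f'' = k² f` on every edge, is continuous
at the vertices, and the sum at every vertex of the derivatives into the edges is zero (a loop
contributes at both of its ends).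
A function on the edge `e` is represented by a function on `ℝ` vanishing outside `[0, length e]`;
all derivatives are taken within `[0, length e]`, hence are one-sided at the endpoints. -/
structure IsEigenpair (Γ : MetricGraph V E) (k : ℂ) (f f' : E → ℝ → ℂ) : Prop where
  support : ∀ e, ∀ x ∉ Set.Icc 0 (Γ.length e), f e x = 0
  deriv_fst : ∀ e, ∀ x ∈ Set.Icc 0 (Γ.length e),
    HasDerivWithinAt (f e) (f' e x) (Set.Icc 0 (Γ.length e)) x
  deriv_snd : ∀ e, ∀ x ∈ Set.Icc 0 (Γ.length e),
    HasDerivWithinAt (f' e) (-(k ^ 2 * f e x)) (Set.Icc 0 (Γ.length e)) x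
  continuous : ∃ φ : V → ℂ, ∀ e, f e 0 = φ (Γ.src e) ∧ f e (Γ.length e) = φ (Γ.tgt e)
  kirchhoff : ∀ v : V,
    ∑ e with Γ.src e = v, f' e 0 + ∑ e with Γ.tgt e = v, -f' e (Γ.length e) = 0

/-- The space of all functions on the graph with `-f'' = k² f` on the edges and standard vertex
conditions. -/
def eigenspace (Γ : MetricGraph V E) (k : ℂ) : Submodule ℂ (E → ℝ → ℂ) where
  carrier := {f | ∃ f', Γ.IsEigenpair k f f'}
  zero_mem' := ⟨0, by
    constructor
    · intros; rfl
    · intro e x _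
      exact hasDerivWithinAt_const x _ (0 : ℂ)
    · intro e x _
      exact (hasDerivWithinAt_const x (Set.Icc 0 (Γ.length e)) (0 : ℂ)).congr_deriv (by simp)
    · exact ⟨0, fun _ => ⟨rfl, rfl⟩⟩
    · intro v; simp⟩
  add_mem' := by
    rintro f g ⟨f', hf⟩ ⟨g', hg⟩
    refine ⟨f' + g', ?_, ?_, ?_, ?_, ?_⟩
    · intro e x hx
      simp [hf.support e x hx, hg.support e x hx]
    · intro e x hx
      exact (hf.deriv_fst e x hx).add (hg.deriv_fst e x hx)
    · intro e x hx
      exact ((hf.deriv_snd e x hx).add (hg.deriv_snd e x hx)).congr_deriv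
        (by simp only [Pi.add_apply]; ring)
    · obtain ⟨φ, hφ⟩ := hf.continuous
      obtain ⟨ψ, hψ⟩ := hg.continuous
      exact ⟨φ + ψ, fun e => ⟨by simp [(hφ e).1, (hψ e).1], by simp [(hφ e).2, (hψ e).2]⟩⟩
    · intro v
      have h1 := hf.kirchhoff v
      have h2 := hg.kirchhoff v
      rw [sum_neg_distrib] at h1 h2
      simp only [Pi.add_apply, neg_add, sum_neg_distrib, sum_add_distrib]
      linear_combination h1 + h2
  smul_mem' := by
    rintro c f ⟨f', hf⟩
    refine ⟨c • f', ?_, ?_, ?_, ?_, ?_⟩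
    · intro e x hx
      simp [hf.support e x hx]
    · intro e x hx
      exact (hf.deriv_fst e x hx).const_smul c
    · intro e x hx
      exact ((hf.deriv_snd e x hx).const_smul c).congr_deriv
        (by simp only [Pi.smul_apply, smul_eq_mul]; ring)
    · obtain ⟨φ, hφ⟩ := hf.continuous
      exact ⟨c • φ, fun e => ⟨by simp [(hφ e).1], by simp [(hφ e).2]⟩⟩
    · intro v
      have h1 := hf.kirchhoff v
      rw [sum_neg_distrib] at h1
      simp only [Pi.smul_apply, smul_eq_mul, sum_neg_distrib, ← mul_sum]
      linear_combination c * h1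

/-- The multiplicity of `k` as an eigenfrequency: the dimension of the space of eigenfunctions. -/
noncomputable def eigenMultiplicity (Γ : MetricGraph V E) (k : ℂ) : ℕ∞ :=
  Cardinal.toENat (Module.rank ℂ (Γ.eigenspace k))

/-- An entire function `S` is a secular function of the graph if its zeros away from `0`, counted
with multiplicity, are exactly the nonzero eigenfrequencies, counted with multiplicity. -/
def IsSecularFunction (Γ : MetricGraph V E) (S : ℂ → ℂ) : Prop :=
  Differentiable ℂ S ∧ ∀ k : ℂ, k ≠ 0 → analyticOrderAt S k = Γ.eigenMultiplicity k

end Spectral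

section Scattering

variable {V E : Type*}

/-- The vertex where the directed edge `b` starts; `(e, false)` is the edge `e` directed from
`src e` to `tgt e`, and `(e, true)` is the same edge with the opposite direction. -/
def origin (Γ : MetricGraph V E) (b : E × Bool) : V := if b.2 then Γ.tgt b.1 else Γ.src b.1

/-- The vertex where the directed edge `b` ends. -/
def terminus (Γ : MetricGraph V E) (b : E × Bool) : V := if b.2 then Γ.src b.1 else Γ.tgt b.1

variable [Fintype E] [DecidableEq V]

/-- The valence of a vertex: the number of edge ends at it. -/
def valence (Γ : MetricGraph V E) (v : V) : ℕ := #{b : E × Bool | Γ.origin b = v}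

variable [DecidableEq E]

/-- The bond scattering matrix for standard vertex conditions: a wave that arrives along the
directed edge `b` at a vertex of valence `d` leaves with amplitude `2/d - 1` along the reversal
of `b` and with amplitude `2/d` along every other directed edge starting at this vertex. -/
noncomputable def bondScattering (Γ : MetricGraph V E) : Matrix (E × Bool) (E × Bool) ℂ :=
  Matrix.of fun b' b =>
    if Γ.origin b' = Γ.terminus b then
      2 / (Γ.valence (Γ.terminus b) : ℂ) - (if b' = (b.1, !b.2) then 1 else 0)
    else 0

/-- The edge scattering matrix. -/
noncomputable def edgeScattering (Γ : MetricGraph V E) (k : ℂ) :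
    Matrix (E × Bool) (E × Bool) ℂ :=
  Matrix.diagonal fun b => Complex.exp (Complex.I * k * Γ.length b.1)

/-- The secular determinant `det (1 - S_v S_e(k))`. -/
noncomputable def secularDet (Γ : MetricGraph V E) (k : ℂ) : ℂ :=
  (1 - Γ.bondScattering * Γ.edgeScattering k).det

end Scattering

/-- Two copies of the graph, attached to each other at every vertex: the two copies of each vertex
are identified, and every edge occurs twice. -/
def double {V E : Type*} (Γ : MetricGraph V E) : MetricGraph V (E ⊕ E) where
  src := Sum.elim Γ.src Γ.src
  tgt := Sum.elim Γ.tgt Γ.tgt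
  length := Sum.elim Γ.length Γ.length
  length_pos := by rintro (e | e) <;> exact Γ.length_pos e

end MetricGraph

/-!
The double `Γ.double` has the symmetry which exchanges the two copies of `Γ`, and everything splits
into a symmetric and an antisymmetric part.

For eigenfunctions: the symmetric part of a solution on the double is a solution on `Γ`
(`IsEigenpair.average`). The antisymmetric part is continuous at the vertices, where the copies meet,
so it vanishes there, and the Kirchhoff condition holds for it by cancellation. It is therefore a
family of independent Dirichlet eigenfunctions, a multiple of `sin (k x)` on each edge
(`IsEigenpair.exists_antisymm_eq_sine`), and such a multiple can be nonzero exactly if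
`sin (k ℓ) = 0`, that is, `exp (2 i k ℓ) = 1`. This gives `eigenMultiplicity_double`. The statement on
secular functions follows because every zero of `exp (i k L) - 1` is simple.

For the secular determinant: the valences of the double are twice those of `Γ`, so with respect to the
two copies the secular matrix has the form `[[A, B], [B, A]]`, with determinant
`det (A + B) * det (A - B)`. The matrix `A + B` is the secular matrix of `Γ`. In `A - B` the
amplitudes `2 / d` cancel, and only the reflections `-1` remain, which couple each
directed edge to its reversal; its determinant is the product of `1 - exp (i k ℓ) ^ 2` over the
edges (`secularDet_double`).
-/

/-! ### Dirichlet eigenfunctions of an edge -/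

namespace MetricGraph

section

variable {V E : Type*}

/-- The function equal to `sin (k x)` on the edge `e` and, as the encoding of functions on an edge
demands, to `0` outside `[0, length e]`. -/
noncomputable def sine (Γ : MetricGraph V E) (k : ℂ) (e : E) : ℝ → ℂ :=
  (Set.Icc 0 (Γ.length e)).indicator fun x => Complex.sin (k * x)

theorem zero_mem_edge (Γ : MetricGraph V E) (e : E) : (0 : ℝ) ∈ Set.Icc 0 (Γ.length e) :=
  ⟨le_rfl, (Γ.length_pos e).le⟩

theorem length_mem_edge (Γ : MetricGraph V E) (e : E) : Γ.length e ∈ Set.Icc 0 (Γ.length e) :=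
  ⟨(Γ.length_pos e).le, le_rfl⟩

theorem hasDerivAt_sin_mul (k : ℂ) (x : ℝ) :
    HasDerivAt (fun y : ℝ => Complex.sin (k * y)) (k * Complex.cos (k * x)) x := by
  have h := (Complex.hasDerivAt_sin (k * x)).comp x (((hasDerivAt_id x).ofReal_comp).const_mul k)
  exact h.congr_deriv (by simp [mul_comm])

theorem hasDerivAt_cos_mul (k : ℂ) (x : ℝ) :
    HasDerivAt (fun y : ℝ => Complex.cos (k * y)) (-(k * Complex.sin (k * x))) x := by
  have h := (Complex.hasDerivAt_cos (k * x)).comp x (((hasDerivAt_id x).ofReal_comp).const_mul k)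
  exact h.congr_deriv (by simp [mul_comm])

theorem sine_apply (Γ : MetricGraph V E) (k : ℂ) {e : E} {x : ℝ}
    (hx : x ∈ Set.Icc 0 (Γ.length e)) : Γ.sine k e x = Complex.sin (k * x) :=
  Set.indicator_of_mem hx _

theorem sine_zero (Γ : MetricGraph V E) (k : ℂ) (e : E) : Γ.sine k e 0 = 0 := by
  simp [Γ.sine_apply k (Γ.zero_mem_edge e)]

theorem hasDerivWithinAt_sine (Γ : MetricGraph V E) (k : ℂ) (e : E) {x : ℝ}
    (hx : x ∈ Set.Icc 0 (Γ.length e)) :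
    HasDerivWithinAt (Γ.sine k e) (k * Complex.cos (k * x)) (Set.Icc 0 (Γ.length e)) x :=
  (hasDerivAt_sin_mul k x).hasDerivWithinAt.congr (fun _ hy => Γ.sine_apply k hy)
    (Γ.sine_apply k hx)

/-- Uniqueness for `-f'' = k² f` with a Dirichlet condition at `0`. -/
theorem eqOn_sin_of_ode {k : ℂ} (hk : k ≠ 0) {l : ℝ} {f f' : ℝ → ℂ}
    (h1 : ∀ x ∈ Set.Icc 0 l, HasDerivWithinAt f (f' x) (Set.Icc 0 l) x)
    (h2 : ∀ x ∈ Set.Icc 0 l, HasDerivWithinAt f' (-(k ^ 2 * f x)) (Set.Icc 0 l) x)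
    (h0 : f 0 = 0) {x : ℝ} (hx : x ∈ Set.Icc 0 l) :
    f x = f' 0 / k * Complex.sin (k * x) := by
  -- `f' cos(kx) + k f sin(kx)` and `f' sin(kx) - k f cos(kx)` are first integrals.
  have hconst {u : ℝ → ℂ} (hu : ∀ x ∈ Set.Icc 0 l, HasDerivWithinAt u 0 (Set.Icc 0 l) x) :
      u x = u 0 :=
    constant_of_derivWithin_zero (fun y hy => (hu y hy).differentiableWithinAt)
      (fun y hy => (hu y ⟨hy.1, hy.2.le⟩).derivWithin
        (uniqueDiffOn_Icc (hy.1.trans_lt hy.2) y ⟨hy.1, hy.2.le⟩)) x hx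
  have hu := hconst (u := fun y => f' y * Complex.cos (k * y) + k * f y * Complex.sin (k * y))
    fun y hy => (((h2 y hy).mul (hasDerivAt_cos_mul k y).hasDerivWithinAt).add
      (((h1 y hy).const_mul k).mul (hasDerivAt_sin_mul k y).hasDerivWithinAt)).congr_deriv (by ring)
  have hw := hconst (u := fun y => f' y * Complex.sin (k * y) - k * f y * Complex.cos (k * y))
    fun y hy => (((h2 y hy).mul (hasDerivAt_sin_mul k y).hasDerivWithinAt).sub
      (((h1 y hy).const_mul k).mul (hasDerivAt_cos_mul k y).hasDerivWithinAt)).congr_deriv (by ring)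
  simp [h0] at hu hw
  field_simp
  linear_combination Complex.sin (k * x) * hu - Complex.cos (k * x) * hw -
    k * f x * Complex.sin_sq_add_cos_sq (k * x)

theorem eq_zero_of_mul_sine_eq_zero (Γ : MetricGraph V E) {k : ℂ} (hk : k ≠ 0) {e : E} {c : ℂ}
    (h : ∀ x, c * Γ.sine k e x = 0) : c = 0 := by
  have h1 := (Γ.hasDerivWithinAt_sine k e (Γ.zero_mem_edge e)).const_mul c
  rw [funext h] at h1
  -- Compare the derivatives `c * k` and `0` at the endpoint `0` of the edge.
  have := (uniqueDiffOn_Icc (Γ.length_pos e) 0 (Γ.zero_mem_edge e)).eq_deriv _ h1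
    (hasDerivWithinAt_const _ _ _)
  simpa [hk] using this

end

/-! ### Eigenfunctions on the double -/

section

variable {V E : Type*} [Fintype E] [DecidableEq V]

/-- The Kirchhoff sum on the double sees only the symmetric part. -/
theorem kirchhoff_double (Γ : MetricGraph V E) (f' : E ⊕ E → ℝ → ℂ) (v : V) :
    ∑ e with Γ.double.src e = v, f' e 0 +
        ∑ e with Γ.double.tgt e = v, -f' e (Γ.double.length e) =
      ∑ e with Γ.src e = v, (f' (.inl e) 0 + f' (.inr e) 0) +
        ∑ e with Γ.tgt e = v, -(f' (.inl e) (Γ.length e) + f' (.inr e) (Γ.length e)) := by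
  have hsrc (F : E ⊕ E → ℂ) : ∑ e with Γ.double.src e = v, F e =
      ∑ e with Γ.src e = v, (F (.inl e) + F (.inr e)) := by
    rw [sum_filter, Fintype.sum_sum_type, sum_add_distrib, sum_filter, sum_filter]
    rfl
  have htgt (F : E ⊕ E → ℂ) : ∑ e with Γ.double.tgt e = v, F e =
      ∑ e with Γ.tgt e = v, (F (.inl e) + F (.inr e)) := by
    rw [sum_filter, Fintype.sum_sum_type, sum_add_distrib, sum_filter, sum_filter]
    rfl
  rw [hsrc, htgt]
  simp only [neg_add, double, Sum.elim_inl, Sum.elim_inr]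

/-- A solution on the graph, extended to both copies and perturbed antisymmetrically by multiples of
Dirichlet eigenfunctions of the edges, is a solution on the double. -/
theorem IsEigenpair.double_add_sine {Γ : MetricGraph V E} {k : ℂ} {g g' : E → ℝ → ℂ}
    (hg : Γ.IsEigenpair k g g') {c : E → ℂ}
    (hc : ∀ e, c e * Complex.sin (k * Γ.length e) = 0) :
    Γ.double.IsEigenpair k
      (Sum.elim (fun e x => g e x + c e * Γ.sine k e x) (fun e x => g e x - c e * Γ.sine k e x))
      (Sum.elim (fun e x => g' e x + c e * (k * Complex.cos (k * x)))
        (fun e x => g' e x - c e * (k * Complex.cos (k * x)))) where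
  support := by
    rintro (e | e) x hx <;>
    · change x ∉ Set.Icc 0 (Γ.length e) at hx
      simp [hg.support e x hx, sine, Set.indicator_of_notMem hx]
  deriv_fst := by
    rintro (e | e) x hx
    · exact (hg.deriv_fst e x hx).add ((Γ.hasDerivWithinAt_sine k e hx).const_mul (c e))
    · exact (hg.deriv_fst e x hx).sub ((Γ.hasDerivWithinAt_sine k e hx).const_mul (c e))
  deriv_snd := by
    rintro (e | e) x hx <;> change x ∈ Set.Icc 0 (Γ.length e) at hx
    · refine ((hg.deriv_snd e x hx).add
        ((hasDerivAt_cos_mul k x).hasDerivWithinAt.const_mul k |>.const_mul (c e))).congr_deriv ?_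
      simp only [Sum.elim_inl, Γ.sine_apply k hx]; ring
    · refine ((hg.deriv_snd e x hx).sub
        ((hasDerivAt_cos_mul k x).hasDerivWithinAt.const_mul k |>.const_mul (c e))).congr_deriv ?_
      simp only [Sum.elim_inr, Γ.sine_apply k hx]; ring
  continuous := by
    obtain ⟨φ, hφ⟩ := hg.continuous
    refine ⟨φ, ?_⟩
    rintro (e | e) <;>
    simp [double, sine_zero, Γ.sine_apply k (Γ.length_mem_edge e), hc, hφ e]
  kirchhoff v := by
    rw [kirchhoff_double, ← mul_zero (2 : ℂ), ← hg.kirchhoff v, mul_add, mul_sum, mul_sum]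
    exact congrArg₂ _ (sum_congr rfl fun e _ => by simp only [Sum.elim_inl, Sum.elim_inr]; ring)
      (sum_congr rfl fun e _ => by simp only [Sum.elim_inl, Sum.elim_inr]; ring)

/-- The symmetric part of a solution on the double is a solution on the graph. -/
theorem IsEigenpair.average {Γ : MetricGraph V E} {k : ℂ} {f f' : E ⊕ E → ℝ → ℂ}
    (hf : Γ.double.IsEigenpair k f f') :
    Γ.IsEigenpair k (fun e x => (f (.inl e) x + f (.inr e) x) / 2)
      (fun e x => (f' (.inl e) x + f' (.inr e) x) / 2) where
  support e x hx := by simp [hf.support (.inl e) x hx, hf.support (.inr e) x hx]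
  deriv_fst e x hx := ((hf.deriv_fst (.inl e) x hx).add (hf.deriv_fst (.inr e) x hx)).div_const 2
  deriv_snd e x hx :=
    (((hf.deriv_snd (.inl e) x hx).add (hf.deriv_snd (.inr e) x hx)).div_const 2).congr_deriv
      (by ring)
  continuous := by
    obtain ⟨φ, hφ⟩ := hf.continuous
    refine ⟨φ, fun e => ?_⟩
    have h1 := hφ (.inl e)
    have h2 := hφ (.inr e)
    simp only [double, Sum.elim_inl, Sum.elim_inr] at h1 h2
    simp [h1, h2]
  kirchhoff v := by
    rw [← zero_div (2 : ℂ), ← hf.kirchhoff v, kirchhoff_double, add_div, sum_div, sum_div]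
    simp only [neg_div]

/-- The antisymmetric part of a solution on the double is continuous, hence zero, at the vertices, so
that on each edge it is a multiple of a Dirichlet eigenfunction. -/
theorem IsEigenpair.exists_antisymm_eq_sine {Γ : MetricGraph V E} {k : ℂ} (hk : k ≠ 0)
    {f f' : E ⊕ E → ℝ → ℂ} (hf : Γ.double.IsEigenpair k f f') (e : E) :
    ∃ c : ℂ, c * Complex.sin (k * Γ.length e) = 0 ∧
      ∀ x, (f (.inl e) x - f (.inr e) x) / 2 = c * Γ.sine k e x := by
  obtain ⟨φ, hφ⟩ := hf.continuous
  have h1 := hφ (.inl e)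
  have h2 := hφ (.inr e)
  simp only [double, Sum.elim_inl, Sum.elim_inr] at h1 h2
  have key := fun x (hx : x ∈ Set.Icc 0 (Γ.length e)) => eqOn_sin_of_ode hk
    (f := fun x => (f (.inl e) x - f (.inr e) x) / 2)
    (f' := fun x => (f' (.inl e) x - f' (.inr e) x) / 2)
    (fun x hx => ((hf.deriv_fst (.inl e) x hx).sub (hf.deriv_fst (.inr e) x hx)).div_const 2)
    (fun x hx => (((hf.deriv_snd (.inl e) x hx).sub
      (hf.deriv_snd (.inr e) x hx)).div_const 2).congr_deriv (by ring))
    (by simp [h1, h2]) hx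
  refine ⟨(f' (.inl e) 0 - f' (.inr e) 0) / 2 / k, ?_, fun x => ?_⟩
  · rw [← key _ (Γ.length_mem_edge e)]
    simp [h1, h2]
  · by_cases hx : x ∈ Set.Icc 0 (Γ.length e)
    · rw [Γ.sine_apply k hx, ← key x hx]
    · simp [hf.support (.inl e) x hx, hf.support (.inr e) x hx, sine,
        Set.indicator_of_notMem hx]

/-- Solutions on the double are given by their symmetric part, a solution on the graph, and by the
coefficients of their antisymmetric part with respect to the Dirichlet eigenfunctions of those edges
which have `k` as a Dirichlet eigenfrequency; on the other edges the coefficient is extended by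
zero. -/
noncomputable def eigenspaceDoubleMap (Γ : MetricGraph V E) (k : ℂ) :
    (Γ.eigenspace k × ({e // Complex.sin (k * Γ.length e) = 0} → ℂ)) →ₗ[ℂ]
      Γ.double.eigenspace k where
  toFun p := ⟨Sum.elim
      (fun e x => p.1.1 e x + Function.extend Subtype.val p.2 0 e * Γ.sine k e x)
      (fun e x => p.1.1 e x - Function.extend Subtype.val p.2 0 e * Γ.sine k e x), by
    obtain ⟨⟨g, g', hg⟩, c⟩ := p
    refine ⟨_, hg.double_add_sine fun e => ?_⟩
    by_cases he : Complex.sin (k * Γ.length e) = 0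
    · rw [he, mul_zero]
    · rw [Function.extend_apply' _ _ _ (by rintro ⟨a, rfl⟩; exact he a.2), Pi.zero_apply, zero_mul]⟩
  map_add' p q := by
    have h (e : E) := congrFun ((Function.ExtendByZero.linearMap ℂ
      (Subtype.val : {e // Complex.sin (k * Γ.length e) = 0} → E)).map_add p.2 q.2) e
    simp only [Function.ExtendByZero.linearMap_apply, Pi.add_apply] at h
    refine Subtype.ext (funext ?_)
    rintro (e | e) <;> funext x
    · refine (congrArg (fun a => (p.1.1 e x + q.1.1 e x) + a * Γ.sine k e x) (h e)).trans ?_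
      exact (by intros; ring : ∀ a b c d s : ℂ,
        a + b + (c + d) * s = (a + c * s) + (b + d * s)) _ _ _ _ _
    · refine (congrArg (fun a => (p.1.1 e x + q.1.1 e x) - a * Γ.sine k e x) (h e)).trans ?_
      exact (by intros; ring : ∀ a b c d s : ℂ,
        a + b - (c + d) * s = (a - c * s) + (b - d * s)) _ _ _ _ _
  map_smul' a p := by
    have h (e : E) := congrFun ((Function.ExtendByZero.linearMap ℂ
      (Subtype.val : {e // Complex.sin (k * Γ.length e) = 0} → E)).map_smul a p.2) e
    simp only [Function.ExtendByZero.linearMap_apply, Pi.smul_apply, smul_eq_mul] at h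
    refine Subtype.ext (funext ?_)
    rintro (e | e) <;> funext x
    · refine (congrArg (fun b => a * p.1.1 e x + b * Γ.sine k e x) (h e)).trans ?_
      exact (by intros; ring : ∀ a b c s : ℂ, a * b + (a * c) * s = a * (b + c * s)) _ _ _ _
    · refine (congrArg (fun b => a * p.1.1 e x - b * Γ.sine k e x) (h e)).trans ?_
      exact (by intros; ring : ∀ a b c s : ℂ, a * b - (a * c) * s = a * (b - c * s)) _ _ _ _

theorem eigenspaceDoubleMap_bijective (Γ : MetricGraph V E) {k : ℂ} (hk : k ≠ 0) :
    Function.Bijective (Γ.eigenspaceDoubleMap k) := by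
  constructor
  · rw [← LinearMap.ker_eq_bot, LinearMap.ker_eq_bot']
    rintro ⟨⟨g, hg⟩, c⟩ h
    have hl (e : E) (x : ℝ) :
        g e x + Function.extend Subtype.val c 0 e * Γ.sine k e x = 0 :=
      congrFun (congrFun (congrArg Subtype.val h) (.inl e)) x
    have hr (e : E) (x : ℝ) :
        g e x - Function.extend Subtype.val c 0 e * Γ.sine k e x = 0 :=
      congrFun (congrFun (congrArg Subtype.val h) (.inr e)) x
    have hg0 : g = 0 := by
      ext e x
      simp only [Pi.zero_apply]
      linear_combination (hl e x + hr e x) / 2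
    have hc0 : c = 0 := by
      ext e
      refine Γ.eq_zero_of_mul_sine_eq_zero hk (e := e.1) fun x => ?_
      rw [← Subtype.val_injective.extend_apply c 0 e]
      linear_combination (hl e x - hr e x) / 2
    simp [hg0, hc0]
  · rintro ⟨f, f', hf⟩
    choose c hc hfc using hf.exists_antisymm_eq_sine hk
    refine ⟨⟨⟨_, _, hf.average⟩, fun e => c e.1⟩, ?_⟩
    have hext : Function.extend (Subtype.val : {e // Complex.sin (k * Γ.length e) = 0} → E)
        (fun e => c e.1) 0 = c := by
      ext e
      by_cases he : Complex.sin (k * Γ.length e) = 0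
      · exact Subtype.val_injective.extend_apply (fun e => c e.1) 0
          (⟨e, he⟩ : {e // Complex.sin (k * Γ.length e) = 0})
      · rw [Function.extend_apply' _ _ _ (by rintro ⟨a, rfl⟩; exact he a.2)]
        exact ((mul_eq_zero.mp (hc e)).resolve_right he).symm
    ext (e | e) x <;> simp only [eigenspaceDoubleMap, LinearMap.coe_mk, AddHom.coe_mk,
      Sum.elim_inl, Sum.elim_inr, hext]
    · linear_combination -hfc e x
    · linear_combination hfc e x

/-- With `z = k l`: the Dirichlet eigenfrequencies of an edge of length `l` are the eigenfrequencies
of a circle of length `2 l`, away from `k = 0`. -/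
theorem sin_eq_zero_iff_exp (z : ℂ) :
    Complex.sin z = 0 ↔ Complex.exp (Complex.I * (2 * z)) = 1 := by
  have h : Complex.exp (Complex.I * (2 * z)) - 1 =
      2 * Complex.I * Complex.exp (Complex.I * z) * Complex.sin z := by
    have e1 : Complex.exp (Complex.I * (2 * z)) = Complex.exp (z * Complex.I) ^ 2 := by
      rw [← Complex.exp_nat_mul]; congr 1; push_cast; ring
    have e2 : Complex.exp (-z * Complex.I) * Complex.exp (z * Complex.I) = 1 := by
      rw [← Complex.exp_add]; simp
    rw [e1, Complex.sin, mul_comm Complex.I z]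
    linear_combination e2 - (Complex.exp (-z * Complex.I) * Complex.exp (z * Complex.I) -
      Complex.exp (z * Complex.I) ^ 2) * Complex.I_sq
  rw [← sub_eq_zero (b := (1 : ℂ)), h]
  simp [Complex.exp_ne_zero]

open Classical in
theorem eigenMultiplicity_double (Γ : MetricGraph V E) {k : ℂ} (hk : k ≠ 0) :
    Γ.double.eigenMultiplicity k = Γ.eigenMultiplicity k +
      ∑ e, if Complex.exp (Complex.I * k * (2 * Γ.length e : ℝ)) = 1 then 1 else 0 := by
  have h := (LinearEquiv.ofBijective _ (Γ.eigenspaceDoubleMap_bijective hk)).rank_eq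
  rw [rank_prod', rank_fun'] at h
  rw [eigenMultiplicity, eigenMultiplicity, ← h, map_add, Cardinal.toENat_nat, Fintype.card_subtype,
    card_filter, Nat.cast_sum]
  refine congrArg _ <| sum_congr rfl fun e _ => ?_
  rw [Nat.cast_ite, Nat.cast_one, Nat.cast_zero]
  refine if_congr ?_ rfl rfl
  rw [sin_eq_zero_iff_exp]
  push_cast
  ring_nf

end

/-! ### Orders of vanishing -/

/-- All zeros of `exp (i k l) - 1` are simple. -/
theorem analyticOrderAt_exp_sub_one {l : ℝ} (hl : l ≠ 0) (k : ℂ) :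
    analyticOrderAt (fun k : ℂ => Complex.exp (Complex.I * k * l) - 1) k =
      if Complex.exp (Complex.I * k * l) = 1 then 1 else 0 := by
  split_ifs with h
  · refine AnalyticAt.analyticOrderAt_eq_one_of_zero_deriv_ne_zero (by fun_prop) (by simp [h]) ?_
    have hd : HasDerivAt (fun k : ℂ => Complex.exp (Complex.I * k * l) - 1)
        (Complex.exp (Complex.I * k * l) * (Complex.I * 1 * l)) k :=
      ((((hasDerivAt_id k).const_mul Complex.I).mul_const (l : ℂ)).cexp).sub_const 1
    rw [hd.deriv, h]
    simpa using hl
  · exact analyticOrderAt_eq_zero.mpr (.inr (by simpa [sub_eq_zero] using h))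

theorem analyticOrderAt_prod {ι : Type*} (s : Finset ι) {F : ι → ℂ → ℂ} {z : ℂ}
    (h : ∀ i ∈ s, AnalyticAt ℂ (F i) z) :
    analyticOrderAt (∏ i ∈ s, F i) z = ∑ i ∈ s, analyticOrderAt (F i) z := by
  classical
  induction s using Finset.induction_on with
  | empty => simpa using analyticOrderAt_eq_zero.mpr (.inr (by simp))
  | insert a s ha ih =>
    rw [prod_insert ha, sum_insert ha, analyticOrderAt_mul (h a (by simp))
      (Finset.analyticAt_prod s fun i hi => h i (by simp [hi])), ih fun i hi => h i (by simp [hi])]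

end MetricGraph

/-! ### Grouping the loops by their lengths -/

@[to_additive]
theorem Multiset.prod_map_sum_replicate {α M ι : Type*} [CommMonoid M] (s : Finset ι) (n : ι → ℕ)
    (L : ι → α) (F : α → M) :
    ((∑ i ∈ s, Multiset.replicate (n i) (L i)).map F).prod = ∏ i ∈ s, F (L i) ^ n i := by
  classical
  induction s using Finset.induction_on with
  | empty => simp
  | insert a s ha ih => simp [sum_insert ha, prod_insert ha, ih]

/-! ### Secular determinants -/

namespace Matrix

theorem det_fromBlocks_swap_symm {n R : Type*} [Fintype n] [DecidableEq n] [CommRing R]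
    (A B : Matrix n n R) :
    (fromBlocks A B B A).det = (A + B).det * (A - B).det := by
  -- Conjugation by `[[1, 0], [1, 1]]` makes the matrix block triangular.
  have h : fromBlocks 1 0 1 1 * fromBlocks A B B A * fromBlocks 1 0 (-1) 1 =
      fromBlocks (A - B) B 0 (A + B) := by
    simp only [fromBlocks_multiply, fromBlocks_inj]
    refine ⟨?_, ?_, ?_, ?_⟩ <;> noncomm_ring
  have h' := congrArg det h
  simp only [det_mul, det_fromBlocks_zero₁₂, det_fromBlocks_zero₂₁, det_one] at h'
  linear_combination h'

/-- A matrix supported on the pairs of mutually reversed elements of `E × Bool` decomposes into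
`2 × 2` blocks, one for each element of `E`. -/
theorem det_one_add_reversal {E R : Type*} [Fintype E] [DecidableEq E] [CommRing R] (z : E → R) :
    (1 + of fun b' b : E × Bool => if b' = (b.1, !b.2) then z b.1 else 0).det =
      ∏ e, (1 - z e ^ 2) := by
  have h : (1 + of fun b' b : E × Bool => if b' = (b.1, !b.2) then z b.1 else 0) =
      (blockDiagonal fun e => of fun i j : Bool => if i = j then 1 else z e).reindex
        (Equiv.prodComm _ _) (Equiv.prodComm _ _) := by
    ext ⟨e, i⟩ ⟨e', j⟩
    by_cases he : e = e'
    · subst he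
      cases i <;> cases j <;> simp [blockDiagonal_apply]
    · simp [blockDiagonal_apply, he]
  rw [h, det_reindex_self, det_blockDiagonal]
  refine prod_congr rfl fun e _ => ?_
  rw [← det_reindex_self finTwoEquiv.symm, det_fin_two]
  simp [finTwoEquiv, sq]

end Matrix

namespace MetricGraph

section

variable {V E : Type*} [Fintype E] [DecidableEq V]

theorem valence_double (Γ : MetricGraph V E) (v : V) : Γ.double.valence v = 2 * Γ.valence v := by
  simp only [valence, card_filter, two_mul]
  rw [← (Equiv.sumProdDistrib E E Bool).symm.sum_comp, Fintype.sum_sum_type]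
  rfl

variable [DecidableEq E]

/-- On symmetric waves the secular matrix of the double acts as that of `Γ`, and on antisymmetric
waves only the reflections with amplitude `-1` remain. -/
theorem secularDet_double (Γ : MetricGraph V E) (k : ℂ) :
    Γ.double.secularDet k =
      Γ.secularDet k * ∏ e, (1 - Complex.exp (Complex.I * k * Γ.length e) ^ 2) := by
  set J : Matrix (E × Bool) (E × Bool) ℂ := Matrix.of fun b' b =>
    if b' = (b.1, !b.2) then Complex.exp (Complex.I * k * Γ.length b.1) else 0 with hJ
  set M : Matrix (E × Bool) (E × Bool) ℂ := Matrix.of fun b' b =>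
    if Γ.origin b' = Γ.terminus b then
      Complex.exp (Complex.I * k * Γ.length b.1) / Γ.valence (Γ.terminus b) else 0 with hM
  have hrev (b' b : E × Bool) (h : b' = (b.1, !b.2)) : Γ.origin b' = Γ.terminus b := by
    subst h; cases h : b.2 <;> simp [origin, terminus, h]
  have hval (d : ℂ) : 2 / (2 * d) = 1 / d := by
    rw [div_mul_eq_div_div, div_self two_ne_zero]
  -- The amplitude `2 / (2 d)` leads into both copies alike, the reflection `-1` into the same copy.
  have hdouble : (1 - Γ.double.bondScattering * Γ.double.edgeScattering k).reindex
      (Equiv.sumProdDistrib E E Bool) (Equiv.sumProdDistrib E E Bool) =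
      Matrix.fromBlocks (1 + J - M) (-M) (-M) (1 + J - M) := by
    have ho (s : Bool) (e : E) : Γ.double.origin (.inl e, s) = Γ.origin (e, s) ∧
      Γ.double.origin (.inr e, s) = Γ.origin (e, s) := ⟨rfl, rfl⟩
    have ht (s : Bool) (e : E) : Γ.double.terminus (.inl e, s) = Γ.terminus (e, s) ∧
      Γ.double.terminus (.inr e, s) = Γ.terminus (e, s) := ⟨rfl, rfl⟩
    have hl (e : E) : Γ.double.length (.inl e) = Γ.length e ∧
      Γ.double.length (.inr e) = Γ.length e := ⟨rfl, rfl⟩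
    ext (⟨e', s'⟩ | ⟨e', s'⟩) (⟨e, s⟩ | ⟨e, s⟩) <;>
    · have hr := hrev (e', s') (e, s)
      simp only [Matrix.reindex_apply, Matrix.submatrix_apply, Equiv.sumProdDistrib_symm_apply_left,
        Equiv.sumProdDistrib_symm_apply_right, Matrix.sub_apply, edgeScattering,
        Matrix.mul_diagonal, bondScattering, Matrix.of_apply, valence_double, Nat.cast_mul,
        Nat.cast_ofNat, hval, ho, ht, hl, Matrix.fromBlocks_apply₁₁, Matrix.fromBlocks_apply₁₂,
        Matrix.fromBlocks_apply₂₁, Matrix.fromBlocks_apply₂₂, Matrix.add_apply, Matrix.neg_apply,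
        hJ, hM, Matrix.one_apply, Prod.mk.injEq, Sum.inl.injEq, Sum.inr.injEq, reduceCtorEq,
        false_and, if_false] at hr ⊢
      split_ifs <;> first | ring1 | (exfalso; tauto)
  have hsingle : 1 - Γ.bondScattering * Γ.edgeScattering k = 1 + J - M + -M := by
    ext b' b
    have hr := hrev b' b
    simp only [Matrix.sub_apply, edgeScattering, Matrix.mul_diagonal, bondScattering,
      Matrix.of_apply, Matrix.add_apply, Matrix.neg_apply, hJ, hM]
    split_ifs <;> first | ring1 | (exfalso; tauto)
  rw [secularDet, secularDet, ← Matrix.det_reindex_self (Equiv.sumProdDistrib E E Bool), hdouble,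
    Matrix.det_fromBlocks_swap_symm, hsingle, sub_neg_eq_add, sub_add_cancel, hJ,
    Matrix.det_one_add_reversal fun e => Complex.exp (Complex.I * k * Γ.length e)]

end
end MetricGraph

/-! ### The double of a metric graph -/

theorem theorem4 {V E : Type*} [Fintype V] [Fintype E] [DecidableEq V] [DecidableEq E]
    (Γ : MetricGraph V E) {m : ℕ} (L : Fin m → ℝ) (n : Fin m → ℕ)
    (hloops : (Finset.univ : Finset E).val.map (fun e => 2 * Γ.length e) =
      ∑ i, Multiset.replicate (n i) (L i)) :
    (∀ S : ℂ → ℂ, Γ.IsSecularFunction S →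
      Γ.double.IsSecularFunction
        (fun k => S k * ∏ i, (Complex.exp (Complex.I * k * L i) - 1) ^ n i)) ∧
    (∀ k : ℂ, Γ.double.secularDet k = (-1) ^ Fintype.card E *
      (Γ.secularDet k * ∏ i, (Complex.exp (Complex.I * k * L i) - 1) ^ n i)) ∧
    (∀ k : ℂ, k ≠ 0 → Γ.double.eigenMultiplicity k = Γ.eigenMultiplicity k +
      ∑ i, if Complex.exp (Complex.I * k * L i) = 1 then (n i : ℕ∞) else 0) := by
  classical
  have hprod (k : ℂ) : ∏ i, (Complex.exp (Complex.I * k * L i) - 1) ^ n i =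
      ∏ e, (Complex.exp (Complex.I * k * (2 * Γ.length e : ℝ)) - 1) := by
    rw [← Multiset.prod_map_sum_replicate univ n L
      fun l : ℝ => Complex.exp (Complex.I * k * l) - 1, ← hloops, Multiset.map_map]
    rfl
  have hsum (k : ℂ) : (∑ i, if Complex.exp (Complex.I * k * L i) = 1 then (n i : ℕ∞) else 0) =
      ∑ e, if Complex.exp (Complex.I * k * (2 * Γ.length e : ℝ)) = 1 then 1 else 0 := by
    have h := Multiset.sum_map_sum_replicate univ n L
      fun l : ℝ => if Complex.exp (Complex.I * k * l) = 1 then (1 : ℕ∞) else 0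
    rw [← hloops, Multiset.map_map] at h
    refine Eq.trans (sum_congr rfl fun i _ => ?_) h.symm
    split_ifs <;> simp
  refine ⟨fun S hS => ⟨?_, fun k hk => ?_⟩, fun k => ?_, fun k hk => ?_⟩
  · exact hS.1.mul (by fun_prop)
  · have hF : (fun k => S k * ∏ i, (Complex.exp (Complex.I * k * L i) - 1) ^ n i) =
        S * ∏ e, fun k : ℂ => Complex.exp (Complex.I * k * (2 * Γ.length e : ℝ)) - 1 := by
      ext z
      rw [hprod, Pi.mul_apply, prod_apply]
    rw [hF, analyticOrderAt_mul (hS.1.analyticAt k)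
      (Finset.analyticAt_prod _ fun e _ => by fun_prop), hS.2 k hk,
      MetricGraph.analyticOrderAt_prod _ fun e _ => by fun_prop,
      Γ.eigenMultiplicity_double hk]
    congr 1
    exact sum_congr rfl fun e _ =>
      MetricGraph.analyticOrderAt_exp_sub_one (mul_pos two_pos (Γ.length_pos e)).ne' k
  · rw [hprod, Γ.secularDet_double, mul_left_comm, Fintype.card, ← prod_const, ← prod_mul_distrib]
    congr 1
    refine prod_congr rfl fun e _ => ?_
    rw [← Complex.exp_nat_mul]
    push_cast
    ring_nf
  · rw [hsum, Γ.eigenMultiplicity_double hk]
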